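/- Let $n,s$ be integers with $1\le s<n$, and let $\mu>0$, $m>0$, $\varepsilon\in(0,1)$. For $S\subseteq\{1,\dots,n\}$ let $x\in\mathbb{R}^n$ be the signal with $x_i=\mu$ for $i\in S$ and $x_i=0$ for $i\notin S$. An adaptive sensing procedure collects measurements $Y_j=x_{A_j}+\Gamma_j^{-1/2}W_j$, $j=1,2,\dots$, where the $W_j$ are i.i.d. standard normal, the entry $A_j\in\{1,\dots,n\}$ and the precision $\Gamma_j$ are chosen, possibly at random, on the basis of the past data $\{Y_i,A_i,\Gamma_i\}_{i<j}$ by a rule that does not depend on $S$, and $W_j$ is independent of $\{A_i,\Gamma_i\}_{i\le j}$ and of the past observations. ($\Gamma_j>0$; the choice $\Gamma_j=0$ is also allowed and means that nothing is observed in step $j$.) Write $\mathbb{P}_S$ and $\mathbb{E}_S$ for the law of $\{Y_i,A_i,\Gamma_i\}_{i\ge1}$ and its expectation when the support is $S$. An estimator $\hat S\subseteq\{1,\dots,n\}$ is a measurable function of $\{Y_i,A_i,\Gamma_i\}_{i\ge1}$. Let $\mathcal{C}$ be the class of $s$-intervals, i.e. the sets $\{i,i+1,\dots,i+s-1\}$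 with $1\le i\le n-s+1$. Consider any adaptive sensing procedure with an estimator $\hat S$ that satisfies the precision budget $\mathbb{E}_S\big(\sum_j\Gamma_j\big)\le m$ for every $S\in\mathcal{C}\cup\{\emptyset\}$. (i) Suppose that $n/s$ is an integer. If $\max_{S\in\mathcal{C}\cup\{\emptyset\}}\mathbb{P}_S(\hat S\ne S)\le\varepsilon$, then necessarily $$\mu\ \ge\ \sqrt{\frac{2n}{sm}\,\log\frac{1}{2\varepsilon}}\ .$$ (ii) If $\max_{S\in\mathcal{C}\cup\{\emptyset\}}\mathbb{E}_S\big(|\hat S\,\triangle\,S|\big)\le\varepsilon$, then necessarily $$\mu\ \ge\ \sqrt{\frac{2(n-s)}{sm}\left(\log\frac{n-s}{n+s}+\log\frac{s}{8\varepsilon}\right)}\ .$$ When the expression under a root is negative, the corresponding bound is understood as $\mu\ge 0$. -/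

import Mathlib

open MeasureTheory ProbabilityTheory
open scoped NNReal ENNReal

namespace AdaptiveSensing

/-- The class of `s`-intervals of a set of `n` linearly ordered indices (numbered from `0` here):
the sets `{i, i + 1, …, i + s - 1}` that fit into `{0, …, n - 1}`. -/
def sIntervals (n s : ℕ) : Set (Finset (Fin n)) :=
  {S | ∃ i : ℕ, i + s ≤ n ∧ ∀ j : Fin n, j ∈ S ↔ i ≤ (j : ℕ) ∧ (j : ℕ) < i + s}

/-- The signal with support `S` and magnitude `μ`. -/
noncomputable def signal {n : ℕ} (μ : ℝ) (S : Finset (Fin n)) (i : Fin n) : ℝ :=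
  if i ∈ S then μ else 0

/-- A sensing action: the entry `A` to be measured and the precision `Γ` of the measurement.
Precision `0` means that nothing is measured. -/
abbrev Action (n : ℕ) : Type := Fin n × ℝ≥0

/-- The data collected in one step: the action `(A, Γ)` and the observation `Y`. -/
abbrev Record (n : ℕ) : Type := Action n × ℝ

/-- The law of the observation `Y = x_A + Γ^{-1/2} W`, with `W` standard normal, given the action
`(A, Γ)`, that is, `N(x_A, 1 / Γ)`. If `Γ = 0`, no information is obtained: the recorded
observation is then the constant `0`, whatever the signal is. -/
noncomputable def obsLaw {n : ℕ} (μ : ℝ) (S : Finset (Fin n)) (a : Action n) : Measure ℝ :=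
  if a.2 = 0 then Measure.dirac 0 else gaussianReal (signal μ S a.1) a.2⁻¹

lemma measurable_obsLaw {n : ℕ} (μ : ℝ) (S : Finset (Fin n)) :
    Measurable (obsLaw μ S : Action n → Measure ℝ) := by
  have h : Measurable (fun a : Action n => (signal μ S a.1, a.2⁻¹)) :=
    ((measurable_of_countable (signal μ S)).comp measurable_fst).prodMk measurable_snd.inv
  exact Measurable.ite (measurable_snd (measurableSet_singleton (0 : ℝ≥0))) measurable_const
    (measurable_gaussianReal.comp h)

/-- The observation as a Markov kernel from actions to real numbers. -/
noncomputable def obsKernel {n : ℕ} (μ : ℝ) (S : Finset (Fin n)) : Kernel (Action n) ℝ :=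
  ⟨obsLaw μ S, measurable_obsLaw μ S⟩

instance {n : ℕ} (μ : ℝ) (S : Finset (Fin n)) : IsMarkovKernel (obsKernel μ S) := by
  refine ⟨fun a => ?_⟩
  change IsProbabilityMeasure (obsLaw μ S a)
  unfold obsLaw
  split_ifs <;> infer_instance

/-- An adaptive sensing and estimation procedure: a (possibly randomized) choice of the first
action, a (possibly randomized) choice of each further action given all the data collected so far,
and an estimator of the support computed from the whole sequence of data. None of these depends on
the unknown support. -/
structure Procedure (n : ℕ) where
  /-- the law of the first action -/
  first : Measure (Action n)
  first_prob : IsProbabilityMeasure first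
  /-- the conditional law of the action of step `j + 1` given the data of the steps `0, …, j` -/
  next : (j : ℕ) → Kernel (Finset.Iic j → Record n) (Action n)
  next_markov : ∀ j, IsMarkovKernel (next j)
  /-- the estimator of the support -/
  estimator : (ℕ → Record n) → Finset (Fin n)
  measurable_estimator : Measurable estimator

namespace Procedure

variable {n : ℕ} (P : Procedure n)

instance : IsProbabilityMeasure P.first := P.first_prob

instance (j : ℕ) : IsMarkovKernel (P.next j) := P.next_markov j

/-- The conditional law of the data of step `j + 1` given the data of the steps `0, …, j`, when the
support is `S`: the action is chosen by the procedure, and given everything so far the observation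
depends on that action only. -/
noncomputable def stepKernel (μ : ℝ) (S : Finset (Fin n)) (j : ℕ) :
    Kernel (Finset.Iic j → Record n) (Record n) :=
  P.next j ⊗ₖ Kernel.prodMkLeft _ (obsKernel μ S)

instance (μ : ℝ) (S : Finset (Fin n)) (j : ℕ) : IsMarkovKernel (P.stepKernel μ S j) := by
  unfold stepKernel
  infer_instance

/-- The joint law `P_S` of the whole sequence `(A_j, Γ_j, Y_j)`, `j = 0, 1, 2, …`, when the signal
has support `S` and magnitude `μ`. -/
noncomputable def law (μ : ℝ) (S : Finset (Fin n)) : Measure (ℕ → Record n) :=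
  Kernel.trajMeasure (X := fun _ => Record n) (P.first ⊗ₘ obsKernel μ S) (P.stepKernel μ S)

instance (μ : ℝ) (S : Finset (Fin n)) : IsProbabilityMeasure (P.law μ S) := by
  unfold law
  infer_instance

/-- The expected total precision `E_S (∑ Γ_j)`, a value in `[0, ∞]`. -/
noncomputable def expectedPrecision (μ : ℝ) (S : Finset (Fin n)) : ℝ≥0∞ :=
  ∫⁻ ω, ∑' j, ((ω j).1.2 : ℝ≥0∞) ∂(P.law μ S)

/-- The probability of error `P_S (Ŝ ≠ S)`. -/
noncomputable def errorProb (μ : ℝ) (S : Finset (Fin n)) : ℝ :=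
  (P.law μ S).real {ω | P.estimator ω ≠ S}

/-- The expected Hamming distance `E_S |Ŝ ∆ S|` (the integrand is bounded and measurable). -/
noncomputable def expectedHamming (μ : ℝ) (S : Finset (Fin n)) : ℝ :=
  ∫ ω, ((symmDiff (P.estimator ω) S).card : ℝ) ∂(P.law μ S)

end Procedure

end AdaptiveSensing

/-! Cut the index set into K = ⌊n/s⌋ disjoint `s`-intervals S_k. Under the empty support the
log-likelihood ratio of a record between S_k and ∅ has conditional mean -μ²/2 times the precision
spent on S_k. So the relative entropy of P_∅ with respect to P_{S_k} is μ²/2 times the null expected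
precision on S_k, and by disjointness these entropies sum to at most μ² m / 2. Only the budget under
∅ is needed.

The entropies are bounded below by the Gibbs variational inequality: θ P_∅(B) - log(1 + (e^θ - 1)
P_{S_k}(B)) is at most the entropy. It is proved on finitely many steps by change of measure
(`lintegral_law_eq`) and Jensen (`exp_integral_le_of_frestrictLe`), then passed to events of the
whole path (`exp_measureReal_le`), which avoids a density on the infinite path. Summation over the
blocks gives `sum_sub_log_le`.

For exact recovery, B_k says that the estimator is not S_k; the complements are disjoint errors
under ∅. For Hamming loss, B_k says that the estimator contains less than half of S_k, and Markov's
inequality controls both probabilities. The two choices of θ leave elementary inequalities for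
logarithms. -/

namespace AdaptiveSensing

/-! ### Likelihood ratio of a single record -/

/-- The log-likelihood ratio of one record between the support `S` and the empty support. -/
noncomputable def logRatio {n : ℕ} (μ : ℝ) (S : Finset (Fin n)) (r : Record n) : ℝ :=
  if r.1.1 ∈ S then (r.1.2 : ℝ) * (μ * r.2 - μ ^ 2 / 2) else 0

/-- The precision that a record spends on the entries in `S`. -/
noncomputable def precisionOn {n : ℕ} (S : Finset (Fin n)) (r : Record n) : ℝ≥0 :=
  if r.1.1 ∈ S then r.1.2 else 0

lemma measurableSet_index_mem {n : ℕ} (S : Finset (Fin n)) :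
    MeasurableSet {r : Record n | r.1.1 ∈ S} :=
  (measurable_fst.comp measurable_fst) (Set.toFinite (S : Set (Fin n))).measurableSet

@[fun_prop]
lemma measurable_logRatio {n : ℕ} (μ : ℝ) (S : Finset (Fin n)) : Measurable (logRatio μ S) :=
  Measurable.ite (measurableSet_index_mem S) (by fun_prop) measurable_const

@[fun_prop]
lemma measurable_precisionOn {n : ℕ} (S : Finset (Fin n)) : Measurable (precisionOn S) :=
  Measurable.ite (measurableSet_index_mem S) (by fun_prop) measurable_const

/-- The density of N(μ, 1/Γ) relative to N(0, 1/Γ) at y is exp(Γ(μy - μ²/2)). If Γ = 0 or the entry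
is outside `S`, the two laws coincide and the ratio is 1. -/
lemma lintegral_obsKernel_eq {n : ℕ} (μ : ℝ) (S : Finset (Fin n)) (a : Action n) {g : ℝ → ℝ≥0∞}
    (hg : Measurable g) :
    ∫⁻ y, g y ∂(obsKernel μ S a) =
      ∫⁻ y, ENNReal.ofReal (Real.exp (logRatio μ S (a, y))) * g y ∂(obsKernel μ ∅ a) := by
  change ∫⁻ y, g y ∂(obsLaw μ S a) = ∫⁻ y, _ ∂(obsLaw μ ∅ a)
  by_cases h0 : a.2 = 0
  · simp [obsLaw, h0, logRatio]
  by_cases hS : a.1 ∈ S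
  · have hv : a.2⁻¹ ≠ 0 := inv_ne_zero h0
    simp only [obsLaw, h0, if_false, signal, hS, if_true, Finset.notMem_empty, logRatio]
    rw [gaussianReal_of_var_ne_zero _ hv, gaussianReal_of_var_ne_zero _ hv,
      lintegral_withDensity_eq_lintegral_mul _ (measurable_gaussianPDF _ _) hg,
      lintegral_withDensity_eq_lintegral_mul _ (measurable_gaussianPDF _ _) (by fun_prop)]
    refine lintegral_congr fun y => ?_
    simp only [Pi.mul_apply, gaussianPDF]
    rw [← mul_assoc, ← ENNReal.ofReal_mul (gaussianPDFReal_nonneg _ _ _)]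
    congr 2
    rw [gaussianPDFReal, gaussianPDFReal, mul_assoc (√_)⁻¹, ← Real.exp_add]
    congr 2
    have : (a.2 : ℝ) ≠ 0 := by exact_mod_cast h0
    push_cast
    field_simp
    ring
  · simp [obsLaw, signal, hS, logRatio]

lemma integrable_logRatio_obsKernel {n : ℕ} (μ : ℝ) (S : Finset (Fin n)) (a : Action n) :
    Integrable (fun y => logRatio μ S (a, y)) (obsKernel μ ∅ a) := by
  change Integrable _ (obsLaw μ ∅ a)
  by_cases hS : a.1 ∈ S
  · simp only [logRatio, hS, if_true]
    refine Integrable.const_mul (Integrable.sub (Integrable.const_mul ?_ _) ?_) _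
    · unfold obsLaw
      split_ifs with h
      · exact integrable_dirac (by simp)
      · exact (memLp_id_gaussianReal 1).integrable (by simp)
    · have : IsProbabilityMeasure (obsLaw μ (∅ : Finset (Fin n)) a) :=
        inferInstanceAs (IsProbabilityMeasure (obsKernel μ ∅ a))
      exact integrable_const _
  · simp [logRatio, hS]

/-- The observation has mean 0 under the empty support, so only the constant term survives. `y₀` is
a dummy: `precisionOn` ignores the observation. -/
lemma integral_logRatio_obsKernel {n : ℕ} (μ : ℝ) (S : Finset (Fin n)) (a : Action n) (y₀ : ℝ) :
    ∫ y, logRatio μ S (a, y) ∂(obsKernel μ ∅ a) = - (μ ^ 2 / 2) * precisionOn S (a, y₀) := by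
  change ∫ y, _ ∂(obsLaw μ ∅ a) = _
  have : IsProbabilityMeasure (obsLaw μ (∅ : Finset (Fin n)) a) :=
    inferInstanceAs (IsProbabilityMeasure (obsKernel μ ∅ a))
  by_cases hS : a.1 ∈ S
  · simp only [logRatio, precisionOn, hS, if_true]
    by_cases h0 : a.2 = 0
    · simp [h0]
    · simp only [obsLaw, h0, if_false, signal, Finset.notMem_empty]
      rw [integral_const_mul, integral_sub, integral_const_mul, integral_id_gaussianReal]
      · simp; ring
      · exact ((memLp_id_gaussianReal 1).integrable (by simp)).const_mul _
      · exact integrable_const _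
  · simp [logRatio, precisionOn, hS]

/-- A bound affine in Γ lets finite expected precision imply integrability of the log-ratio along
the path. -/
lemma integral_norm_logRatio_obsKernel_le {n : ℕ} (μ : ℝ) (S : Finset (Fin n)) (a : Action n) :
    ∫ y, ‖logRatio μ S (a, y)‖ ∂(obsKernel μ ∅ a) ≤ μ ^ 2 * a.2 + 1 := by
  change ∫ y, _ ∂(obsLaw μ ∅ a) ≤ _
  have : IsProbabilityMeasure (obsLaw μ (∅ : Finset (Fin n)) a) :=
    inferInstanceAs (IsProbabilityMeasure (obsKernel μ ∅ a))
  by_cases hS : a.1 ∈ S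
  · by_cases h0 : a.2 = 0
    · simp [logRatio, h0]
    · have h0' : (0 : ℝ) < a.2 := by exact_mod_cast pos_iff_ne_zero.2 h0
      have hsq : Integrable (fun y : ℝ => y ^ 2) (gaussianReal 0 a.2⁻¹) :=
        (memLp_id_gaussianReal 2).integrable_sq
      have hvar : ∫ y, y ^ 2 ∂(gaussianReal 0 a.2⁻¹) = (a.2 : ℝ)⁻¹ := by
        have h := variance_fun_id_gaussianReal (μ := 0) (v := a.2⁻¹)
        rw [variance_of_integral_eq_zero (by fun_prop) (by simp [integral_id_gaussianReal])] at h
        simpa using h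
      have hI := integrable_logRatio_obsKernel μ S a
      change Integrable _ (obsLaw μ ∅ a) at hI
      simp only [logRatio, obsLaw, h0, hS, if_true, if_false, signal, Finset.notMem_empty] at hI ⊢
      calc ∫ y, ‖(a.2 : ℝ) * (μ * y - μ ^ 2 / 2)‖ ∂(gaussianReal 0 a.2⁻¹)
          ≤ ∫ y, (μ ^ 2 * a.2 + a.2 / 2 * y ^ 2) ∂(gaussianReal 0 a.2⁻¹) := by
            refine integral_mono hI.norm ((integrable_const _).add (hsq.const_mul _)) fun y => ?_
            simp only [norm_mul, Real.norm_eq_abs, abs_of_pos h0']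
            -- The split is chosen so that y² meets the factor Γ/2: as E y² = 1/Γ, this term
            -- contributes 1/2 for every Γ.
            have : |μ * y - μ ^ 2 / 2| ≤ μ ^ 2 + y ^ 2 / 2 := by
              rw [abs_le]
              constructor <;> nlinarith [sq_nonneg (μ - y), sq_nonneg (μ + y), sq_nonneg y,
                sq_nonneg μ]
            calc (a.2 : ℝ) * |μ * y - μ ^ 2 / 2| ≤ a.2 * (μ ^ 2 + y ^ 2 / 2) := by gcongr
              _ = _ := by ring
        _ = μ ^ 2 * a.2 + 1 / 2 := by
            rw [integral_add (integrable_const _) (hsq.const_mul _), integral_const_mul (a.2 / 2 : ℝ),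
              hvar, integral_const]
            simp; field_simp
        _ ≤ _ := by linarith
  · simp [logRatio, hS]; positivity

/-! ### Law of the data and change of measure -/

namespace Procedure

variable {n : ℕ} (P : Procedure n)

open Preorder

lemma map_eval_zero_law (μ : ℝ) (S : Finset (Fin n)) :
    (P.law μ S).map (fun ω => ω 0) = P.first ⊗ₘ obsKernel μ S := by
  have h : (fun ω : ℕ → Record n => ω 0) =
      (fun x : Finset.Iic 0 → Record n => x ⟨0, by simp⟩) ∘
        frestrictLe (π := fun _ => Record n) 0 := rfl
  rw [h, ← Measure.map_map (by fun_prop) (by fun_prop), law, Kernel.trajMeasure,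
    Measure.map_comp _ _ (by fun_prop), Kernel.traj_map_frestrictLe, Kernel.partialTraj_self,
    Measure.id_comp, Measure.map_map (by fun_prop) (by fun_prop)]
  exact Measure.map_id

/-- Tower property: condition on the first records, then on the next action. `S` enters the inner
integrals only through the observation kernel. -/
lemma lintegral_law_succ (μ : ℝ) (S : Finset (Fin n)) (N : ℕ)
    {h : (Finset.Iic N → Record n) → Record n → ℝ≥0∞} (hh : Measurable (Function.uncurry h)) :
    ∫⁻ ω, h (frestrictLe N ω) (ω (N + 1)) ∂(P.law μ S) =
      ∫⁻ ω, ∫⁻ a, ∫⁻ y, h (frestrictLe N ω) (a, y) ∂(obsKernel μ S a)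
        ∂(P.next N (frestrictLe N ω)) ∂(P.law μ S) := by
  have key := Kernel.map_frestrictLe_trajMeasure_compProd_eq_map_trajMeasure
    (X := fun _ => Record n) (μ₀ := P.first ⊗ₘ obsKernel μ S) (κ := P.stepKernel μ S) (a := N)
  change (P.law μ S).map _ ⊗ₘ _ = (P.law μ S).map _ at key
  calc _ = ∫⁻ p, Function.uncurry h p ∂((P.law μ S).map
        (fun x ↦ (frestrictLe (π := fun _ => Record n) N x, x (N + 1)))) := by
        rw [lintegral_map hh (by fun_prop)]; rfl
    _ = ∫⁻ x, ∫⁻ r, h x r ∂(P.stepKernel μ S N x) ∂((P.law μ S).map (frestrictLe N)) := by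
        rw [← key, Measure.lintegral_compProd hh]; rfl
    _ = ∫⁻ ω, ∫⁻ r, h (frestrictLe N ω) r ∂(P.stepKernel μ S N (frestrictLe N ω))
          ∂(P.law μ S) := by
        exact lintegral_map (Measurable.lintegral_kernel_prod_right' hh) (by fun_prop)
    _ = _ := by
        refine lintegral_congr fun ω => ?_
        have hm : Measurable (h (frestrictLe N ω)) :=
          hh.comp (measurable_const.prodMk measurable_id)
        exact Kernel.lintegral_compProd _ _ _ hm

/-- The law of each record: an action drawn from some distribution, and the observation it leads
to. -/
lemma exists_map_eval_law_eq (μ : ℝ) (S : Finset (Fin n)) (j : ℕ) :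
    ∃ ρ : Measure (Action n), IsProbabilityMeasure ρ ∧
      (P.law μ S).map (fun ω => ω j) = ρ ⊗ₘ obsKernel μ S := by
  cases j with
  | zero => exact ⟨P.first, inferInstance, P.map_eval_zero_law μ S⟩
  | succ N =>
    have : IsProbabilityMeasure ((P.law μ S).map
      (frestrictLe (π := fun _ => Record n) N)) :=
      Measure.isProbabilityMeasure_map (by fun_prop)
    refine ⟨P.next N ∘ₘ ((P.law μ S).map (frestrictLe N)), inferInstance, ?_⟩
    refine Measure.ext_of_lintegral _ fun F hF => ?_
    have hG : Measurable fun a => ∫⁻ y, F (a, y) ∂(obsKernel μ S a) :=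
      hF.lintegral_kernel_prod_right'
    rw [lintegral_map hF (by fun_prop), Measure.lintegral_compProd hF,
      Measure.lintegral_bind (by fun_prop) hG.aemeasurable,
      lintegral_map (hG.lintegral_kernel) (by fun_prop)]
    exact P.lintegral_law_succ μ S N (h := fun _ r => F r) (hF.comp measurable_snd)

/-- Extension of a sequence of records by one more. -/
def appendRecord {N : ℕ} (x : Finset.Iic N → Record n) (r : Record n) :
    Finset.Iic (N + 1) → Record n :=
  fun i => if h : (i : ℕ) ≤ N then x ⟨i, Finset.mem_Iic.2 h⟩ else r

lemma measurable_appendRecord {N : ℕ} :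
    Measurable (Function.uncurry (appendRecord (n := n) (N := N))) := by
  refine measurable_pi_lambda _ fun i => ?_
  by_cases h : (i : ℕ) ≤ N
  · simp only [Function.uncurry_def, appendRecord, h, dif_pos]
    fun_prop
  · simp only [Function.uncurry_def, appendRecord, h]
    exact measurable_snd

lemma appendRecord_frestrictLe {N : ℕ} (ω : ℕ → Record n) :
    appendRecord (frestrictLe (π := fun _ => Record n) N ω) (ω (N + 1)) =
      frestrictLe (π := fun _ => Record n) (N + 1) ω := by
  ext1 ⟨i, hi⟩
  simp only [appendRecord, frestrictLe_apply]
  split_ifs with h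
  · rfl
  · have : i = N + 1 := le_antisymm (Finset.mem_Iic.1 hi) (by simpa using h)
    rw [this]

/-- Change of measure: on the data of the steps `0, …, N`, the law under the support `S` has the
likelihood ratio as its density with respect to the law under the empty support. -/
theorem lintegral_law_eq (μ : ℝ) (S : Finset (Fin n)) (N : ℕ)
    {g : (Finset.Iic N → Record n) → ℝ≥0∞} (hg : Measurable g) :
    ∫⁻ ω, g (frestrictLe N ω) ∂(P.law μ S) =
      ∫⁻ ω, (∏ j ∈ Finset.Iic N, ENNReal.ofReal (Real.exp (logRatio μ S (ω j)))) *
        g (frestrictLe N ω) ∂(P.law μ ∅) := by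
  induction N with
  | zero =>
    have hF : Measurable fun r : Record n => g (fun _ => r) := by fun_prop
    have h0 (ω : ℕ → Record n) : frestrictLe (π := fun _ => Record n) 0 ω = fun _ => ω 0 := by
      ext1 ⟨i, hi⟩
      have : i = 0 := by simpa using hi
      subst this
      rfl
    have hI : Finset.Iic 0 = {0} := rfl
    simp only [h0, hI, Finset.prod_singleton]
    rw [← lintegral_map (f := fun r => g fun _ => r) (g := fun ω : ℕ → Record n => ω 0) hF
        (by fun_prop),
      ← lintegral_map (f := fun r => ENNReal.ofReal (Real.exp (logRatio μ S r)) * g fun _ => r)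
        (g := fun ω : ℕ → Record n => ω 0) (by fun_prop) (by fun_prop),
      map_eval_zero_law, map_eval_zero_law, Measure.lintegral_compProd hF,
      Measure.lintegral_compProd (by fun_prop)]
    exact lintegral_congr fun a => lintegral_obsKernel_eq μ S a (by fun_prop)
  | succ N ih =>
    have hh : Measurable (Function.uncurry fun x r => g (appendRecord (n := n) (N := N) x r)) :=
      hg.comp measurable_appendRecord
    have hh' : Measurable (Function.uncurry fun (x : Finset.Iic N → Record n) (r : Record n) =>
        (∏ i, ENNReal.ofReal (Real.exp (logRatio μ S (x i)))) *
          (ENNReal.ofReal (Real.exp (logRatio μ S r)) * g (appendRecord x r))) := by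
      refine Measurable.mul ?_ (Measurable.mul ?_ hh)
      · fun_prop
      · fun_prop
    have hI : Finset.Iic (N + 1) = insert (N + 1) (Finset.Iic N) := by ext; simp; omega
    have hprod (ω : ℕ → Record n) := Finset.prod_coe_sort (Finset.Iic N)
      (fun j => ENNReal.ofReal (Real.exp (logRatio μ S (ω j))))
    have hG : Measurable fun x : Finset.Iic N → Record n =>
        ∫⁻ a, ∫⁻ y, g (appendRecord x (a, y)) ∂(obsKernel μ S a) ∂(P.next N x) := by
      have h1 : Measurable fun p : (Finset.Iic N → Record n) × Action n =>
          ∫⁻ y, g (appendRecord p.1 (p.2, y)) ∂(Kernel.prodMkLeft _ (obsKernel μ S) p) :=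
        Measurable.lintegral_kernel_prod_right'
          (f := fun q : ((Finset.Iic N → Record n) × Action n) × ℝ =>
            g (appendRecord q.1.1 (q.1.2, q.2)))
          (hh.comp (f := fun q : ((Finset.Iic N → Record n) × Action n) × ℝ =>
            (q.1.1, (q.1.2, q.2))) (by fun_prop))
      exact Measurable.lintegral_kernel_prod_right' h1
    calc ∫⁻ ω, g (frestrictLe (N + 1) ω) ∂(P.law μ S)
        = ∫⁻ ω, g (appendRecord (frestrictLe N ω) (ω (N + 1))) ∂(P.law μ S) := by
          simp only [appendRecord_frestrictLe]
      _ = ∫⁻ ω, (∏ j ∈ Finset.Iic N, ENNReal.ofReal (Real.exp (logRatio μ S (ω j)))) *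
            ∫⁻ a, ∫⁻ y, g (appendRecord (frestrictLe N ω) (a, y)) ∂(obsKernel μ S a)
              ∂(P.next N (frestrictLe N ω)) ∂(P.law μ ∅) := by
          -- The kernel `P.next N` is common to both supports, so the induction hypothesis applies
          -- to the function of the past obtained by integrating out the last record.
          rw [P.lintegral_law_succ μ S N hh, ← ih hG]
      _ = ∫⁻ ω, (∫⁻ a, ∫⁻ y, (∏ j : Finset.Iic N,
              ENNReal.ofReal (Real.exp (logRatio μ S (frestrictLe N ω j)))) *
            (ENNReal.ofReal (Real.exp (logRatio μ S (a, y))) *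
              g (appendRecord (frestrictLe N ω) (a, y))) ∂(obsKernel μ ∅ a)
              ∂(P.next N (frestrictLe N ω))) ∂(P.law μ ∅) := by
          refine lintegral_congr fun ω => ?_
          have hfin : (∏ j ∈ Finset.Iic N,
              ENNReal.ofReal (Real.exp (logRatio μ S (ω j)))) ≠ ∞ :=
            ENNReal.prod_ne_top fun _ _ => ENNReal.ofReal_ne_top
          rw [← lintegral_const_mul' _ _ hfin]
          refine lintegral_congr fun a => ?_
          rw [lintegral_obsKernel_eq μ S a (g := fun y => g (appendRecord (frestrictLe N ω) (a, y)))
            (hh.comp (f := fun y : ℝ => (frestrictLe N ω, ((a, y) : Record n))) (by fun_prop)),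
            ← lintegral_const_mul' _ _ hfin, ← hprod]
          rfl
      _ = _ := by
          rw [← P.lintegral_law_succ μ ∅ N hh']
          refine lintegral_congr fun ω => ?_
          rw [appendRecord_frestrictLe, hI, Finset.prod_insert (by simp), ← hprod]
          simp only [frestrictLe_apply]
          ring

/-! ### Precision spent on a set and the entropy inequality -/

/-- The expected total precision spent on the entries in `S` when the support is empty. -/
noncomputable def nullPrecisionOn (μ : ℝ) (S : Finset (Fin n)) : ℝ≥0∞ :=
  ∫⁻ ω, ∑' j, (precisionOn S (ω j) : ℝ≥0∞) ∂(P.law μ ∅)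

lemma integrable_precision {μ : ℝ} (hP : P.expectedPrecision μ ∅ ≠ ∞) (j : ℕ) :
    Integrable (fun ω : ℕ → Record n => ((ω j).1.2 : ℝ)) (P.law μ ∅) := by
  refine ⟨Measurable.aestronglyMeasurable (by fun_prop), ?_⟩
  rw [HasFiniteIntegral]
  refine lt_of_le_of_lt (lintegral_mono fun ω => ?_) (lt_top_iff_ne_top.2 hP)
  simpa using ENNReal.le_tsum (f := fun j => ((ω j).1.2 : ℝ≥0∞)) j

lemma precisionOn_le (S : Finset (Fin n)) (r : Record n) : precisionOn S r ≤ r.1.2 := by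
  unfold precisionOn; split_ifs <;> simp

lemma integrable_precisionOn {μ : ℝ} (hP : P.expectedPrecision μ ∅ ≠ ∞) (S : Finset (Fin n))
    (j : ℕ) : Integrable (fun ω : ℕ → Record n => (precisionOn S (ω j) : ℝ)) (P.law μ ∅) := by
  refine (P.integrable_precision hP j).mono' (Measurable.aestronglyMeasurable (by fun_prop))
    (ae_of_all _ fun ω => ?_)
  simpa using precisionOn_le S (ω j)

lemma integrable_logRatio_law {μ : ℝ} (hP : P.expectedPrecision μ ∅ ≠ ∞) (S : Finset (Fin n))
    (j : ℕ) : Integrable (fun ω : ℕ → Record n => logRatio μ S (ω j)) (P.law μ ∅) ∧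
      ∫ ω, logRatio μ S (ω j) ∂(P.law μ ∅) =
        - (μ ^ 2 / 2) * ∫ ω, (precisionOn S (ω j) : ℝ) ∂(P.law μ ∅) := by
  obtain ⟨ρ, hρ, h⟩ := P.exists_map_eval_law_eq μ ∅ j
  have hev : Measurable fun ω : ℕ → Record n => ω j := by fun_prop
  have hΓ : Integrable (fun r : Record n => (r.1.2 : ℝ)) (ρ ⊗ₘ obsKernel μ ∅) := by
    rw [← h, integrable_map_measure (by fun_prop) hev.aemeasurable]
    exact P.integrable_precision hP j
  have hΓ' : Integrable (fun a : Action n => (a.2 : ℝ)) ρ := by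
    rw [← Measure.fst_compProd ρ (obsKernel μ (∅ : Finset (Fin n))), Measure.fst,
      integrable_map_measure (by fun_prop) (by fun_prop)]
    exact hΓ
  have hI : Integrable (logRatio μ S) (ρ ⊗ₘ obsKernel μ ∅) := by
    rw [Measure.integrable_compProd_iff (by fun_prop)]
    refine ⟨ae_of_all _ fun a => integrable_logRatio_obsKernel μ S a, ?_⟩
    refine ((hΓ'.const_mul (μ ^ 2)).add (integrable_const 1)).mono' ?_
      (ae_of_all _ fun a => ?_)
    · exact ((measurable_logRatio μ S).norm.stronglyMeasurable.integral_kernel_prod_right'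
        (κ := obsKernel μ ∅)).aestronglyMeasurable
    · rw [Real.norm_of_nonneg (integral_nonneg fun _ => norm_nonneg _)]
      exact integral_norm_logRatio_obsKernel_le μ S a
  have hpm : Integrable (fun r : Record n => (precisionOn S r : ℝ)) (ρ ⊗ₘ obsKernel μ ∅) :=
    hΓ.mono' (by fun_prop) (ae_of_all _ fun r => by simpa using precisionOn_le S r)
  refine ⟨?_, ?_⟩
  · rw [← h, integrable_map_measure (by fun_prop) hev.aemeasurable] at hI
    exact hI
  · rw [← integral_map (f := logRatio μ S) hev.aemeasurable (by fun_prop),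
      ← integral_map (f := fun r : Record n => (precisionOn S r : ℝ)) hev.aemeasurable
        (by fun_prop), h, Measure.integral_compProd hI, Measure.integral_compProd hpm,
      ← integral_const_mul]
    refine integral_congr_ae (ae_of_all _ fun a => ?_)
    simp only [integral_logRatio_obsKernel μ S a 0]
    simp [precisionOn]

lemma sum_integral_precisionOn_le {μ : ℝ} (hP : P.expectedPrecision μ ∅ ≠ ∞)
    (S : Finset (Fin n)) (I : Finset ℕ) :
    ∑ j ∈ I, ∫ ω, (precisionOn S (ω j) : ℝ) ∂(P.law μ ∅) ≤ (P.nullPrecisionOn μ S).toReal := by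
  have hfin : P.nullPrecisionOn μ S ≠ ∞ := by
    refine ne_top_of_le_ne_top hP (lintegral_mono fun ω => ?_)
    exact ENNReal.tsum_le_tsum fun j => by exact_mod_cast precisionOn_le S (ω j)
  rw [← integral_finsetSum _ fun j _ => P.integrable_precisionOn hP S j,
    integral_eq_lintegral_of_nonneg_ae (ae_of_all _ fun ω => by positivity)
      (Measurable.aestronglyMeasurable (by fun_prop))]
  refine ENNReal.toReal_mono hfin (lintegral_mono fun ω => ?_)
  rw [ENNReal.ofReal_sum_of_nonneg fun _ _ => by positivity]
  simp only [ENNReal.ofReal_coe_nnreal]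
  exact ENNReal.sum_le_tsum _

/-- The convex exponential lies below its chord between 0 and θ. This makes the final bound depend
on the test function only through its mean. -/
lemma exp_mul_le {θ x : ℝ} (h0 : 0 ≤ x) (h1 : x ≤ 1) :
    Real.exp (θ * x) ≤ 1 + (Real.exp θ - 1) * x := by
  have := convexOn_exp.2 (Set.mem_univ 0) (Set.mem_univ θ) (sub_nonneg.2 h1) h0 (by ring)
  simp only [smul_eq_mul, mul_zero, zero_add, Real.exp_zero, mul_one] at this
  rw [mul_comm θ]
  linarith

/-- The Gibbs variational inequality for the relative entropy of the two laws of the data of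
finitely many steps. -/
lemma exp_integral_le_of_frestrictLe {μ : ℝ} (hP : P.expectedPrecision μ ∅ ≠ ∞)
    (S : Finset (Fin n)) (N : ℕ) {f : (Finset.Iic N → Record n) → ℝ} (hf : Measurable f)
    (h0 : ∀ x, 0 ≤ f x) (h1 : ∀ x, f x ≤ 1) (θ : ℝ) :
    Real.exp (θ * ∫ ω, f (frestrictLe N ω) ∂(P.law μ ∅) -
        μ ^ 2 / 2 * (P.nullPrecisionOn μ S).toReal) ≤
      1 + (Real.exp θ - 1) * ∫ ω, f (frestrictLe N ω) ∂(P.law μ S) := by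
  have hfr : Measurable (frestrictLe (π := fun _ : ℕ => Record n) N) := by fun_prop
  have hfi (T : Finset (Fin n)) :
      Integrable (fun ω : ℕ → Record n => f (frestrictLe N ω)) (P.law μ T) :=
    Integrable.of_bound (hf.comp hfr).aestronglyMeasurable 1
      (ae_of_all _ fun ω => by rw [Real.norm_of_nonneg (h0 _)]; exact h1 _)
  have hfm : Measurable fun ω : ℕ → Record n => f (frestrictLe N ω) := hf.comp hfr
  -- exp L is the tilt e^{θf} times the likelihood ratio, so its null mean is the mean of e^{θf}
  -- under `S`; Jensen's inequality bounds that below by exp of the null mean of L.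
  set L : (ℕ → Record n) → ℝ := fun ω =>
    θ * f (frestrictLe N ω) + ∑ j ∈ Finset.Iic N, logRatio μ S (ω j) with hL
  have hLi : Integrable L (P.law μ ∅) := ((hfi ∅).const_mul θ).add
    (integrable_finsetSum _ fun j _ => (P.integrable_logRatio_law hP S j).1)
  have hLint : ∫ ω, L ω ∂(P.law μ ∅) = θ * ∫ ω, f (frestrictLe N ω) ∂(P.law μ ∅) -
      μ ^ 2 / 2 * ∑ j ∈ Finset.Iic N, ∫ ω, (precisionOn S (ω j) : ℝ) ∂(P.law μ ∅) := by
    rw [hL, integral_add ((hfi ∅).const_mul θ)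
      (integrable_finsetSum _ fun j _ => (P.integrable_logRatio_law hP S j).1),
      integral_const_mul, integral_finsetSum _ fun j _ => (P.integrable_logRatio_law hP S j).1,
      Finset.mul_sum, sub_eq_add_neg, ← Finset.sum_neg_distrib]
    congr 1
    exact Finset.sum_congr rfl fun j _ => by
      rw [(P.integrable_logRatio_law hP S j).2, neg_mul]
  have hbound : ∀ ω : ℕ → Record n, Real.exp (θ * f (frestrictLe N ω)) ≤
      1 + (Real.exp θ - 1) * f (frestrictLe N ω) := fun ω => exp_mul_le (h0 _) (h1 _)
  have hexpi : Integrable (fun ω : ℕ → Record n => Real.exp (θ * f (frestrictLe N ω)))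
      (P.law μ S) :=
    ((integrable_const 1).add ((hfi S).const_mul _)).mono'
      (Measurable.aestronglyMeasurable (by fun_prop))
      (ae_of_all _ fun ω => by rw [Real.norm_of_nonneg (Real.exp_pos _).le]; exact hbound ω)
  have hchange : ∫⁻ ω, ENNReal.ofReal (Real.exp (L ω)) ∂(P.law μ ∅) =
      ∫⁻ ω, ENNReal.ofReal (Real.exp (θ * f (frestrictLe N ω))) ∂(P.law μ S) := by
    rw [P.lintegral_law_eq μ S N (g := fun x => ENNReal.ofReal (Real.exp (θ * f x)))
      (by fun_prop)]
    refine lintegral_congr fun ω => ?_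
    rw [hL, Real.exp_add, mul_comm, Real.exp_sum, ENNReal.ofReal_mul (by positivity),
      ENNReal.ofReal_prod_of_nonneg fun _ _ => (Real.exp_pos _).le]
  have hLei : Integrable (fun ω => Real.exp (L ω)) (P.law μ ∅) := by
    refine ⟨by fun_prop, ?_⟩
    rw [hasFiniteIntegral_iff_ofReal (ae_of_all _ fun _ => (Real.exp_pos _).le), hchange,
      ← hasFiniteIntegral_iff_ofReal (ae_of_all _ fun _ => (Real.exp_pos _).le)]
    exact hexpi.2
  have hjensen : Real.exp (∫ ω, L ω ∂(P.law μ ∅)) ≤ ∫ ω, Real.exp (L ω) ∂(P.law μ ∅) :=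
    convexOn_exp.map_integral_le Real.continuous_exp.continuousOn isClosed_univ
      (ae_of_all _ fun _ => Set.mem_univ _) hLi hLei
  calc _ ≤ Real.exp (∫ ω, L ω ∂(P.law μ ∅)) := by
        rw [hLint]
        gcongr
        exact P.sum_integral_precisionOn_le hP S _
    _ ≤ ∫ ω, Real.exp (L ω) ∂(P.law μ ∅) := hjensen
    _ = ∫ ω, Real.exp (θ * f (frestrictLe N ω)) ∂(P.law μ S) := by
        rw [integral_eq_lintegral_of_nonneg_ae (ae_of_all _ fun _ => (Real.exp_pos _).le)
          hLei.1, hchange, ← integral_eq_lintegral_of_nonneg_ae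
          (ae_of_all _ fun _ => (Real.exp_pos _).le) hexpi.1]
    _ ≤ ∫ ω, (1 + (Real.exp θ - 1) * f (frestrictLe N ω)) ∂(P.law μ S) :=
        integral_mono hexpi ((integrable_const 1).add ((hfi S).const_mul _)) hbound
    _ = _ := by
        rw [integral_add (integrable_const 1) ((hfi S).const_mul _), integral_const_mul]
        simp

end Procedure
-- From finitely many steps to the whole path
open Preorder Filter Topology

lemma iSup_piLE_eq {X : ℕ → Type*} [∀ i, MeasurableSpace (X i)] :
    ⨆ N, (Filtration.piLE (X := X)) N = MeasurableSpace.pi := by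
  refine le_antisymm (iSup_le fun N => Filtration.le _ N) ?_
  refine iSup_le fun i => le_trans ?_ (le_iSup (Filtration.piLE (X := X)) i)
  rw [Filtration.piLE_eq_comap_frestrictLe]
  have h : (fun x : (j : ℕ) → X j => x i) =
      (fun y : (j : Finset.Iic i) → X j => y ⟨i, by simp⟩) ∘ frestrictLe i := rfl
  rw [h, ← MeasurableSpace.comap_comp]
  exact MeasurableSpace.comap_mono (Measurable.comap_le (by fun_prop))

/-- An event of a sequence space can be approximated by functions of finitely many coordinates,
simultaneously for two finite measures. -/
lemma exists_tendsto_integral_frestrictLe {X : ℕ → Type*} [∀ i, MeasurableSpace (X i)]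
    (μ ν : Measure (∀ i, X i)) [IsFiniteMeasure μ] [IsFiniteMeasure ν] {B : Set (∀ i, X i)}
    (hB : MeasurableSet B) :
    ∃ f : (N : ℕ) → ((i : Finset.Iic N) → X i) → ℝ, (∀ N, Measurable (f N)) ∧
      (∀ N x, 0 ≤ f N x) ∧ (∀ N x, f N x ≤ 1) ∧
      Tendsto (fun N => ∫ ω, f N (frestrictLe N ω) ∂μ) atTop (𝓝 (μ.real B)) ∧
      Tendsto (fun N => ∫ ω, f N (frestrictLe N ω) ∂ν) atTop (𝓝 (ν.real B)) := by
  set χ : (∀ i, X i) → ℝ := B.indicator 1 with hχ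
  have hχm : Measurable χ := measurable_one.indicator hB
  have hχi (ρ : Measure (∀ i, X i)) [IsFiniteMeasure ρ] : Integrable χ ρ :=
    (integrable_const (1 : ℝ)).indicator hB
  -- Lévy's upward theorem under `μ + ν`: its L¹ convergence passes to both measures, since each is
  -- dominated by the sum.
  have hconv := (hχi (μ + ν)).tendsto_eLpNorm_condExp (ℱ := Filtration.piLE)
    (by rw [iSup_piLE_eq]; exact hχm.stronglyMeasurable)
  have hex (N : ℕ) : ∃ h : ((i : Finset.Iic N) → X i) → ℝ, Measurable h ∧
      (μ + ν)[χ | Filtration.piLE N] = h ∘ frestrictLe N := by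
    have hs : StronglyMeasurable[MeasurableSpace.pi.comap (frestrictLe (π := X) N)]
        ((μ + ν)[χ | Filtration.piLE N]) := by
      rw [← Filtration.piLE_eq_comap_frestrictLe]
      exact stronglyMeasurable_condExp
    obtain ⟨h, hm, hh⟩ := hs.measurable.exists_eq_measurable_comp
    exact ⟨h, hm, hh⟩
  choose h hm hh using hex
  -- Conditional expectations lie in [0, 1] only almost everywhere. Clipping makes this pointwise
  -- and does not increase the distance to an indicator.
  have hcm (N : ℕ) : Measurable fun x => max 0 (min 1 (h N x)) :=
    measurable_const.max (measurable_const.min (hm N))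
  have hlim (ρ : Measure (∀ i, X i)) [IsFiniteMeasure ρ] (hρ : ρ ≤ μ + ν) :
      Tendsto (fun N => ∫ ω, max 0 (min 1 (h N (frestrictLe N ω))) ∂ρ) atTop
        (𝓝 (ρ.real B)) := by
    have hB' : ∫ ω, χ ω ∂ρ = ρ.real B := integral_indicator_one hB
    rw [← hB']
    refine tendsto_integral_of_L1' χ (hχi ρ).1 (Eventually.of_forall fun N => ?_) ?_
    · exact Integrable.of_bound ((hcm N).comp (by fun_prop)).aestronglyMeasurable 1
        (ae_of_all _ fun ω => by
          rw [Real.norm_of_nonneg (le_max_left _ _)]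
          exact max_le zero_le_one (min_le_left _ _))
    · refine tendsto_of_tendsto_of_tendsto_of_le_of_le tendsto_const_nhds hconv
        (fun _ => zero_le) fun N => ?_
      refine le_trans (eLpNorm_mono_real (g := fun ω => ‖((μ + ν)[χ | Filtration.piLE N] - χ) ω‖)
        fun ω => ?_) ?_
      · simp only [Pi.sub_apply, hh, Function.comp_apply, Real.norm_eq_abs]
        have hω : χ ω = 0 ∨ χ ω = 1 := by
          by_cases hω : ω ∈ B <;> simp [hχ, hω]
        rcases hω with hω | hω <;> rw [hω]
        · rcases max_cases 0 (min 1 (h N (frestrictLe N ω))) with h1 | h1 <;>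
          rcases min_cases 1 (h N (frestrictLe N ω)) with h2 | h2 <;>
          grind
        · rcases max_cases 0 (min 1 (h N (frestrictLe N ω))) with h1 | h1 <;>
          rcases min_cases 1 (h N (frestrictLe N ω)) with h2 | h2 <;>
          grind
      · rw [eLpNorm_norm]
        exact eLpNorm_mono_measure _ hρ
  exact ⟨fun N x => max 0 (min 1 (h N x)), hcm, fun _ _ => le_max_left _ _,
    fun _ _ => max_le zero_le_one (min_le_left _ _), hlim μ (Measure.le_add_right le_rfl),
    hlim ν (Measure.le_add_left le_rfl)⟩

namespace Procedure

variable {n : ℕ} (P : Procedure n)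

/-- The Gibbs variational inequality for the laws of the whole data and an event. -/
theorem exp_measureReal_le {μ : ℝ} (hP : P.expectedPrecision μ ∅ ≠ ∞) (S : Finset (Fin n))
    {B : Set (ℕ → Record n)} (hB : MeasurableSet B) (θ : ℝ) :
    Real.exp (θ * (P.law μ ∅).real B - μ ^ 2 / 2 * (P.nullPrecisionOn μ S).toReal) ≤
      1 + (Real.exp θ - 1) * (P.law μ S).real B := by
  obtain ⟨f, hf, h0, h1, hl, hl'⟩ :=
    exists_tendsto_integral_frestrictLe (P.law μ ∅) (P.law μ S) hB
  refine le_of_tendsto_of_tendsto' (Real.continuous_exp.continuousAt.tendsto.comp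
    ((hl.const_mul θ).sub_const _)) ((hl'.const_mul _).const_add 1) fun N => ?_
  exact P.exp_integral_le_of_frestrictLe hP S N (hf N) (h0 N) (h1 N) θ

end Procedure
-- Disjoint blocks and the shared budget
/-- The `k`-th of the consecutive disjoint `s`-intervals of `{0, …, n - 1}`. -/
def block (n s k : ℕ) : Finset (Fin n) :=
  Finset.univ.filter fun j => k * s ≤ (j : ℕ) ∧ (j : ℕ) < k * s + s

lemma mem_block {n s k : ℕ} {j : Fin n} :
    j ∈ block n s k ↔ k * s ≤ (j : ℕ) ∧ (j : ℕ) < k * s + s := by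
  simp [block]

lemma add_one_mul_le {n s k : ℕ} (hk : k < n / s) : k * s + s ≤ n := by
  have h := Nat.mul_le_mul_right s (Nat.succ_le_of_lt hk)
  have h' := Nat.div_mul_le_self n s
  rw [Nat.succ_mul] at h
  omega

lemma block_mem_sIntervals {n s k : ℕ} (hk : k < n / s) : block n s k ∈ sIntervals n s :=
  ⟨k * s, add_one_mul_le hk, fun _ => mem_block⟩

lemma eq_of_mem_block {n s k l : ℕ} {j : Fin n} (hk : j ∈ block n s k) (hl : j ∈ block n s l) :
    k = l := by
  rw [mem_block] at hk hl
  have h1 := Nat.div_eq_of_lt_le hk.1 (by rw [Nat.succ_mul]; exact hk.2)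
  have h2 := Nat.div_eq_of_lt_le hl.1 (by rw [Nat.succ_mul]; exact hl.2)
  omega

lemma card_block {n s k : ℕ} (hk : k < n / s) : (block n s k).card = s := by
  have h := add_one_mul_le hk
  have : (block n s k).map Fin.valEmbedding = Finset.Ico (k * s) (k * s + s) := by
    ext i
    simp only [Finset.mem_map, mem_block, Fin.valEmbedding_apply, Finset.mem_Ico]
    constructor
    · rintro ⟨j, hj, rfl⟩
      exact hj
    · intro hi
      exact ⟨⟨i, by omega⟩, hi, rfl⟩
  rw [← Finset.card_map, this, Nat.card_Ico]
  omega

namespace Procedure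

variable {n : ℕ} (P : Procedure n)

/-- The blocks are disjoint, so each measurement is charged to at most one of them. -/
lemma sum_precisionOn_block_le (s K : ℕ) (r : Record n) :
    ∑ k ∈ Finset.range K, precisionOn (block n s k) r ≤ r.1.2 := by
  by_cases h : ∃ k ∈ Finset.range K, r.1.1 ∈ block n s k
  · obtain ⟨k, hk, hr⟩ := h
    rw [Finset.sum_eq_single_of_mem k hk]
    · exact precisionOn_le _ r
    · intro l _ hl
      exact if_neg fun h' => hl (eq_of_mem_block h' hr)
  · push Not at h
    rw [Finset.sum_eq_zero fun k hk => show precisionOn (block n s k) r = 0 from if_neg (h k hk)]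
    exact zero_le

lemma sum_nullPrecisionOn_block_le {μ m : ℝ} (hm : 0 ≤ m)
    (hP : P.expectedPrecision μ ∅ ≤ ENNReal.ofReal m) (s K : ℕ) :
    ∑ k ∈ Finset.range K, (P.nullPrecisionOn μ (block n s k)).toReal ≤ m := by
  have hle : ∑ k ∈ Finset.range K, P.nullPrecisionOn μ (block n s k) ≤ ENNReal.ofReal m := by
    refine le_trans ?_ hP
    unfold nullPrecisionOn
    rw [← lintegral_finsetSum _ fun k _ => by fun_prop]
    refine lintegral_mono fun ω => ?_
    rw [← Summable.tsum_finsetSum fun _ _ => ENNReal.summable]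
    refine ENNReal.tsum_le_tsum fun j => ?_
    exact_mod_cast sum_precisionOn_block_le s K (ω j)
  rw [← ENNReal.toReal_sum]
  · exact ENNReal.toReal_le_of_le_ofReal hm hle
  · exact fun k hk => ne_top_of_le_ne_top ENNReal.ofReal_ne_top
      (le_trans (Finset.single_le_sum (f := fun k => P.nullPrecisionOn μ (block n s k))
        (fun _ _ => zero_le) hk) hle)

/-- Bound on the precision needed to separate the empty support from each of several disjoint
intervals by means of the events `B k`. -/
lemma sum_sub_log_le {μ m : ℝ} (hm : 0 ≤ m) (hP : P.expectedPrecision μ ∅ ≤ ENNReal.ofReal m)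
    (s K : ℕ) {B : ℕ → Set (ℕ → Record n)} (hB : ∀ k, MeasurableSet (B k)) {β θ : ℝ}
    (hθ : 0 ≤ θ) (hβ : ∀ k ∈ Finset.range K, (P.law μ (block n s k)).real (B k) ≤ β) :
    θ * ∑ k ∈ Finset.range K, (P.law μ ∅).real (B k) -
      K * Real.log (1 + (Real.exp θ - 1) * β) ≤ μ ^ 2 / 2 * m := by
  have hfin : P.expectedPrecision μ ∅ ≠ ∞ := ne_top_of_le_ne_top ENNReal.ofReal_ne_top hP
  have hθ' : 0 ≤ Real.exp θ - 1 := by linarith [Real.one_le_exp hθ]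
  have hstep : ∀ k ∈ Finset.range K, θ * (P.law μ ∅).real (B k) -
      μ ^ 2 / 2 * (P.nullPrecisionOn μ (block n s k)).toReal ≤
        Real.log (1 + (Real.exp θ - 1) * β) := by
    intro k hk
    -- As θ ≥ 0, the right side increases with the probability under the block, which may be
    -- replaced by β.
    have h := (P.exp_measureReal_le hfin (block n s k) (hB k) θ).trans
      (add_le_add_right (mul_le_mul_of_nonneg_left (hβ k hk) hθ') 1)
    exact (Real.le_log_iff_exp_le ((Real.exp_pos _).trans_le h)).2 h
  have hsum := Finset.sum_le_sum hstep
  rw [Finset.sum_sub_distrib, ← Finset.mul_sum, ← Finset.mul_sum, Finset.sum_const,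
    Finset.card_range, nsmul_eq_mul] at hsum
  have := mul_le_mul_of_nonneg_left (P.sum_nullPrecisionOn_block_le hm hP s K)
    (by positivity : 0 ≤ μ ^ 2 / 2)
  linarith

lemma measurableSet_estimator (q : Finset (Fin n) → Prop) :
    MeasurableSet {ω | q (P.estimator ω)} :=
  P.measurable_estimator (MeasurableSet.of_discrete (s := {T | q T}))

lemma integrable_hamming (μ : ℝ) (S T : Finset (Fin n)) :
    Integrable (fun ω => ((symmDiff (P.estimator ω) T).card : ℝ)) (P.law μ S) := by
  have hm : Measurable fun ω => ((symmDiff (P.estimator ω) T).card : ℝ) :=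
    (measurable_of_countable fun R : Finset (Fin n) => ((symmDiff R T).card : ℝ)).comp
      P.measurable_estimator
  refine Integrable.of_bound hm.aestronglyMeasurable n (ae_of_all _ fun ω => ?_)
  rw [Real.norm_of_nonneg (by positivity)]
  exact_mod_cast (Finset.card_le_univ _).trans_eq (Fintype.card_fin n)

/-- Markov's inequality at level s/2. -/
lemma measureReal_le_of_expectedHamming_le {μ ε : ℝ} {S : Finset (Fin n)}
    (h : P.expectedHamming μ S ≤ ε) {s : ℕ} (hs : 0 < s) {B : Set (ℕ → Record n)}
    (hB : ∀ ω ∈ B, s ≤ 2 * (symmDiff (P.estimator ω) S).card) :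
    (P.law μ S).real B ≤ 2 * ε / s := by
  have hs' : (0 : ℝ) < s := by exact_mod_cast hs
  have hmarkov := mul_meas_ge_le_integral_of_nonneg (ae_of_all _ fun ω => by positivity)
    (P.integrable_hamming μ S S) (s / 2 : ℝ)
  have hsub : (P.law μ S).real B ≤
      (P.law μ S).real {ω | (s / 2 : ℝ) ≤ ((symmDiff (P.estimator ω) S).card : ℝ)} := by
    refine measureReal_mono fun ω hω => ?_
    have : (s : ℝ) ≤ 2 * ((symmDiff (P.estimator ω) S).card : ℝ) := by exact_mod_cast hB ω hω
    simp only [Set.mem_ofPred_eq]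
    linarith
  rw [le_div_iff₀ hs']
  unfold expectedHamming at h
  nlinarith

end Procedure

/-! ### Inequalities for logarithms -/

/-- The per-block bound of exact recovery at θ = log(2/ε). Applying log x ≤ x - 1 at x = 1/(2ε) and
x = (3 - ε)/4 reduces it to log 2 < 3/4. -/
lemma log_inv_two_mul_le {ε : ℝ} (h0 : 0 < ε) (h1 : 2 * ε < 1) :
    Real.log (1 / (2 * ε)) ≤ Real.log (2 / ε) * (1 - ε / 2) - Real.log (3 - ε) := by
  have hlog2 := Real.log_two_lt_d9
  have hA : Real.log (1 / (2 * ε)) = Real.log (2 / ε) - 2 * Real.log 2 := by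
    rw [one_div, Real.log_inv, Real.log_mul (by norm_num) h0.ne', Real.log_div (by norm_num) h0.ne']
    ring
  have hB : Real.log (2 / ε) ≤ 1 / (2 * ε) - 1 + 2 * Real.log 2 := by
    have := Real.log_le_sub_one_of_pos (x := 1 / (2 * ε)) (by positivity)
    linarith
  have hC : Real.log (3 - ε) ≤ 2 * Real.log 2 + ((3 - ε) / 4 - 1) := by
    have := Real.log_le_sub_one_of_pos (x := (3 - ε) / 4) (by linarith)
    rw [Real.log_div (by linarith) (by norm_num), show (4 : ℝ) = 2 ^ 2 by norm_num,
      Real.log_pow] at this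
    push_cast at this
    linarith
  have hD : ε / 2 * Real.log (2 / ε) ≤ 1 / 4 + ε / 2 * (2 * Real.log 2 - 1) := by
    calc ε / 2 * Real.log (2 / ε) ≤ ε / 2 * (1 / (2 * ε) - 1 + 2 * Real.log 2) := by gcongr
      _ = _ := by field_simp; ring
  nlinarith

/-- The per-block bound of Hamming recovery at θ = log(1/δ). The loss δ log(1/δ) + log(2 - δ) is at
most 1/2 + log 2, hence below 2 log 2. -/
lemma log_inv_four_mul_le {δ : ℝ} (h0 : 0 < δ) (h1 : 4 * δ < 1) :
    Real.log (1 / (4 * δ)) ≤ Real.log (1 / δ) * (1 - δ) - Real.log (2 - δ) := by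
  have hlog2 := Real.log_two_gt_d9
  have hA : Real.log (1 / (4 * δ)) = Real.log (1 / δ) - 2 * Real.log 2 := by
    rw [one_div, Real.log_inv, Real.log_mul (by norm_num) h0.ne', one_div, Real.log_inv,
      show (4 : ℝ) = 2 ^ 2 by norm_num, Real.log_pow]
    push_cast; ring
  have hC : Real.log (2 - δ) ≤ Real.log 2 := Real.log_le_log (by linarith) (by linarith)
  have hD : δ * Real.log (1 / δ) ≤ 1 / 2 := by
    have h2 := Real.log_le_sub_one_of_pos (x := 1 / (2 * δ)) (by positivity)
    have h3 : Real.log (1 / (2 * δ)) = Real.log (1 / δ) - Real.log 2 := by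
      rw [one_div, Real.log_inv, Real.log_mul (by norm_num) h0.ne', one_div, Real.log_inv]
      ring
    have := Real.log_two_lt_d9
    calc δ * Real.log (1 / δ) ≤ δ * (1 / (2 * δ) - 1 + Real.log 2) := by gcongr; linarith
      _ = 1 / 2 + δ * (Real.log 2 - 1) := by field_simp; ring
      _ ≤ _ := by nlinarith
  nlinarith

/-! ### The two lower bounds on the precision -/

namespace Procedure

variable {n : ℕ} (P : Procedure n)

/-- Lower bound for exact recovery. -/
lemma mul_log_le_of_errorProb_le {s : ℕ} (hs : 1 ≤ s) (hn : 2 ≤ n / s) {μ m ε : ℝ} (hm : 0 ≤ m)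
    (hε : 0 < ε) (hε1 : 2 * ε < 1) (hP : P.expectedPrecision μ ∅ ≤ ENNReal.ofReal m)
    (herr : ∀ S ∈ sIntervals n s ∪ {∅}, P.errorProb μ S ≤ ε) :
    (n / s : ℕ) * Real.log (1 / (2 * ε)) ≤ μ ^ 2 / 2 * m := by
  set K := n / s with hK
  have hθ : 0 ≤ Real.log (2 / ε) := Real.log_nonneg (by rw [le_div_iff₀ hε]; linarith)
  have hmeas (k : ℕ) : MeasurableSet {ω | P.estimator ω = block n s k} :=
    P.measurableSet_estimator (· = block n s k)
  have key := P.sum_sub_log_le (μ := μ) hm hP s K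
    (B := fun k => {ω | P.estimator ω = block n s k}ᶜ) (fun k => (hmeas k).compl) (β := ε) hθ
    (fun k hk => herr _ (Or.inl (block_mem_sIntervals (Finset.mem_range.1 hk))))
  -- Distinct blocks are distinct nonempty sets, so these events are disjoint and each is an error
  -- under ∅: the total is ε, not K ε.
  have hsum : ∑ k ∈ Finset.range K, (P.law μ ∅).real {ω | P.estimator ω = block n s k} ≤ ε := by
    have hne : ∀ k ∈ Finset.range K, (block n s k).Nonempty := fun k hk => by
      rw [← Finset.card_pos, card_block (Finset.mem_range.1 hk)]; exact hs
    rw [← measureReal_biUnion_finset]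
    · refine le_trans (measureReal_mono ?_) (herr ∅ (Or.inr rfl))
      refine Set.iUnion₂_subset fun k hk ω hω => ?_
      simp only [Set.mem_ofPred_eq] at hω ⊢
      rw [hω]
      exact (hne k hk).ne_empty
    · intro k hk l _ hkl
      refine Set.disjoint_left.2 fun ω (h1 : _ = _) (h2 : _ = _) => hkl ?_
      obtain ⟨j, hj⟩ := hne k hk
      exact eq_of_mem_block hj (by rwa [← h2, h1])
    · exact fun k _ => hmeas k
  simp only [probReal_compl_eq_one_sub (hmeas _), Finset.sum_sub_distrib, Finset.sum_const,
    Finset.card_range, nsmul_eq_mul, mul_one] at key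
  have hexp : 1 + (Real.exp (Real.log (2 / ε)) - 1) * ε = 3 - ε := by
    rw [Real.exp_log (by positivity)]; field_simp; ring
  rw [hexp] at key
  -- Two blocks give ε ≤ (K/2) ε, whence the factor 1 - ε/2 per block.
  have hK2 : (2 : ℝ) ≤ K := by exact_mod_cast hn
  calc (K : ℝ) * Real.log (1 / (2 * ε))
      ≤ K * (Real.log (2 / ε) * (1 - ε / 2) - Real.log (3 - ε)) := by
        gcongr; exact log_inv_two_mul_le hε hε1
    _ = Real.log (2 / ε) * (K - K / 2 * ε) - K * Real.log (3 - ε) := by ring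
    _ ≤ Real.log (2 / ε) * (K - ∑ k ∈ Finset.range K,
          (P.law μ ∅).real {ω | P.estimator ω = block n s k}) - K * Real.log (3 - ε) := by
        gcongr; nlinarith
    _ ≤ _ := key

/-- Lower bound for recovery up to a small expected Hamming distance. -/
lemma mul_log_le_of_expectedHamming_le {s : ℕ} (hs : 1 ≤ s) {μ m ε : ℝ} (hm : 0 ≤ m)
    (hε : 0 < ε) (hε1 : 8 * ε < s) (hP : P.expectedPrecision μ ∅ ≤ ENNReal.ofReal m)
    (herr : ∀ S ∈ sIntervals n s ∪ {∅}, P.expectedHamming μ S ≤ ε) :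
    (n / s : ℕ) * Real.log (s / (8 * ε)) ≤ μ ^ 2 / 2 * m := by
  set K := n / s with hK
  have hs' : (0 : ℝ) < s := by exact_mod_cast hs
  set δ : ℝ := 2 * ε / s with hδ
  have hδ0 : 0 < δ := by positivity
  have hδ1 : 4 * δ < 1 := by
    rw [hδ, ← mul_div_assoc, div_lt_one hs']; linarith
  have hθ : 0 ≤ Real.log (1 / δ) := Real.log_nonneg (by rw [le_div_iff₀ hδ0]; linarith)
  have hmeas (k : ℕ) : MeasurableSet {ω | s ≤ 2 * (P.estimator ω ∩ block n s k).card} :=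
    P.measurableSet_estimator fun T => s ≤ 2 * (T ∩ block n s k).card
  have key := P.sum_sub_log_le (μ := μ) hm hP s K
    (B := fun k => {ω | s ≤ 2 * (P.estimator ω ∩ block n s k).card}ᶜ)
    (fun k => (hmeas k).compl) (β := δ) hθ (fun k hk => by
      -- Missing more than half of the block costs Hamming distance at least s/2 from it; under ∅,
      -- covering at least half costs the same.
      refine P.measureReal_le_of_expectedHamming_le
        (herr _ (Or.inl (block_mem_sIntervals (Finset.mem_range.1 hk)))) hs fun ω hω => ?_
      have hω' : ¬ s ≤ 2 * (P.estimator ω ∩ block n s k).card := hω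
      have h1 := Finset.card_sdiff_add_card_inter (block n s k) (P.estimator ω)
      rw [card_block (Finset.mem_range.1 hk), Finset.inter_comm] at h1
      have h2 : (block n s k \ P.estimator ω).card ≤
          (symmDiff (P.estimator ω) (block n s k)).card :=
        Finset.card_le_card (by rw [symmDiff_def]; exact le_sup_right)
      omega)
  have hnull (k : ℕ) : (P.law μ ∅).real {ω | s ≤ 2 * (P.estimator ω ∩ block n s k).card} ≤ δ := by
    refine P.measureReal_le_of_expectedHamming_le (herr ∅ (Or.inr rfl)) hs fun ω hω => ?_
    have hω' : s ≤ 2 * (P.estimator ω ∩ block n s k).card := hω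
    have h1 : (P.estimator ω ∩ block n s k).card ≤ (P.estimator ω).card :=
      Finset.card_le_card Finset.inter_subset_left
    rw [← Finset.bot_eq_empty, symmDiff_bot]
    omega
  simp only [probReal_compl_eq_one_sub (hmeas _)] at key
  have hexp : 1 + (Real.exp (Real.log (1 / δ)) - 1) * δ = 2 - δ := by
    rw [Real.exp_log (by positivity)]; field_simp; ring
  rw [hexp] at key
  have hfrac : (s : ℝ) / (8 * ε) = 1 / (4 * δ) := by
    rw [hδ]; field_simp; ring
  have hsum : (K : ℝ) * (1 - δ) ≤ ∑ k ∈ Finset.range K,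
      (1 - (P.law μ ∅).real {ω | s ≤ 2 * (P.estimator ω ∩ block n s k).card}) := by
    have := Finset.card_nsmul_le_sum (Finset.range K) (fun k =>
      1 - (P.law μ ∅).real {ω | s ≤ 2 * (P.estimator ω ∩ block n s k).card}) (1 - δ)
      fun k _ => by linarith [hnull k]
    simpa using this
  calc (K : ℝ) * Real.log (s / (8 * ε))
      ≤ K * (Real.log (1 / δ) * (1 - δ) - Real.log (2 - δ)) := by
        rw [hfrac]; gcongr; exact log_inv_four_mul_le hδ0 hδ1
    _ = Real.log (1 / δ) * (K * (1 - δ)) - K * Real.log (2 - δ) := by ring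
    _ ≤ _ := by gcongr
    _ ≤ _ := key

end Procedure

end AdaptiveSensing

/-! ### The theorem -/

theorem proposition15 (n s : ℕ) (hs : 1 ≤ s) (hsn : s < n) (μ m ε : ℝ) (hμ : 0 < μ) (hm : 0 < m)
    (hε : 0 < ε) (hε1 : ε < 1) (P : AdaptiveSensing.Procedure n)
    (hbudget : ∀ S ∈ AdaptiveSensing.sIntervals n s ∪ {∅},
      P.expectedPrecision μ S ≤ ENNReal.ofReal m) :
    (s ∣ n → (∀ S ∈ AdaptiveSensing.sIntervals n s ∪ {∅}, P.errorProb μ S ≤ ε) →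
      μ ≥ Real.sqrt (2 * (n : ℝ) / ((s : ℝ) * m) * Real.log (1 / (2 * ε)))) ∧
    ((∀ S ∈ AdaptiveSensing.sIntervals n s ∪ {∅}, P.expectedHamming μ S ≤ ε) →
      μ ≥ Real.sqrt (2 * ((n : ℝ) - (s : ℝ)) / ((s : ℝ) * m) *
        (Real.log (((n : ℝ) - (s : ℝ)) / ((n : ℝ) + (s : ℝ))) +
          Real.log ((s : ℝ) / (8 * ε))))) := by
  have hP := hbudget ∅ (Or.inr rfl)
  have hs' : (0 : ℝ) < s := by exact_mod_cast hs
  have hsn' : (s : ℝ) < n := by exact_mod_cast hsn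
  refine ⟨fun hdvd herr => ?_, fun herr => ?_⟩
  · refine Real.sqrt_le_iff.2 ⟨hμ.le, ?_⟩
    by_cases h2 : 2 * ε < 1
    · obtain ⟨K, rfl⟩ := hdvd
      have hdiv : s * K / s = K := Nat.mul_div_cancel_left K hs
      have hK : 2 ≤ K := by
        by_contra hK
        have : s * K ≤ s * 1 := Nat.mul_le_mul_left s (by omega)
        omega
      have key := P.mul_log_le_of_errorProb_le hs (hdiv.symm ▸ hK) hm.le hε h2 hP herr
      rw [hdiv] at key
      calc 2 * ((s * K : ℕ) : ℝ) / (s * m) * Real.log (1 / (2 * ε))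
          = 2 / m * (K * Real.log (1 / (2 * ε))) := by push_cast; field_simp
        _ ≤ 2 / m * (μ ^ 2 / 2 * m) := by gcongr
        _ = μ ^ 2 := by field_simp
    · refine le_trans (mul_nonpos_of_nonneg_of_nonpos (by positivity) ?_) (sq_nonneg μ)
      exact Real.log_nonpos (by positivity) ((div_le_one (by positivity)).2 (by linarith))
  -- This term only weakens the claim, so it is dropped.
  · have hlog : Real.log (((n : ℝ) - s) / (n + s)) ≤ 0 :=
      Real.log_nonpos (div_nonneg (by linarith) (by linarith))
        ((div_le_one (by linarith)).2 (by linarith))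
    have hns : 0 < (n : ℝ) - s := by linarith
    refine Real.sqrt_le_iff.2 ⟨hμ.le, ?_⟩
    by_cases h8 : 8 * ε < s
    · have key := P.mul_log_le_of_expectedHamming_le hs hm.le hε h8 hP herr
      have hL : 0 ≤ Real.log (s / (8 * ε)) :=
        Real.log_nonneg ((one_le_div (by positivity)).2 h8.le)
      -- Rounding n/s down loses less than one block; this is the source of n - s in place of n.
      have hK : ((n : ℝ) - s) / s ≤ (n / s : ℕ) := by
        have h : n < s * (n / s + 1) := Nat.lt_mul_div_succ n hs
        have h' : (n : ℝ) < s * ((n / s : ℕ) + 1) := by exact_mod_cast h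
        rw [div_le_iff₀ hs']
        linarith
      calc 2 * ((n : ℝ) - s) / (s * m) *
            (Real.log (((n : ℝ) - s) / (n + s)) + Real.log (s / (8 * ε)))
          ≤ 2 * ((n : ℝ) - s) / (s * m) * Real.log (s / (8 * ε)) := by
            gcongr; linarith
        _ = 2 / m * (((n : ℝ) - s) / s * Real.log (s / (8 * ε))) := by field_simp
        _ ≤ 2 / m * ((n / s : ℕ) * Real.log (s / (8 * ε))) := by gcongr
        _ ≤ 2 / m * (μ ^ 2 / 2 * m) := by gcongr
        _ = μ ^ 2 := by field_simp
    · refine le_trans (mul_nonpos_of_nonneg_of_nonpos (by positivity) ?_) (sq_nonneg μ)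
      have : Real.log (s / (8 * ε)) ≤ 0 :=
        Real.log_nonpos (by positivity) ((div_le_one (by positivity)).2 (by linarith))
      linarith
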